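/- **Setting.** Let $n\ge 1$, $K\ge 1$ and $p_1,\dots,p_K\ge 1$ be integers, $p=\sum_{k=1}^K p_k$, and let $x=[x_1;\cdots;x_K]\in\mathbb{R}^p$ be a fixed vector with blocks $x_k\in\mathbb{R}^{p_k}$. Let $A=[A_1,\dots,A_K]\in\mathbb{R}^{n\times p}$, with $A_k\in\mathbb{R}^{n\times p_k}$, be a random matrix whose rows are i.i.d. $\mathcal{N}(0,I_p)$, and let $y=Ax$ be the noiseless observations. **Algorithm (CoCoA).** For a regularization parameter $\lambda\ge 0$, start from $\hat{x}_k^0=0\in\mathbb{R}^{p_k}$ and $v_k^0=0\in\mathbb{R}^n$ for all $k$. For $t=0,1,2,\dots$ put $\bar v^t=\frac1K\sum_{k=1}^K v_k^t$ and, for every $k=1,\dots,K$, $$\Delta x_k^t=-(K A_k^{\mathrm T}A_k+\lambda I_{p_k})^{+}\bigl(\lambda \hat{x}_k^t-A_k^{\mathrm T}(y-\bar v^t)\bigr),\qquad \hat{x}_k^{t+1}=\hat{x}_k^t+\Delta x_k^t,\qquad v_k^{t+1}=\bar v^t+K A_k\Delta x_k^t ,$$ where $M^+$ denotes the Moore–Penrose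 pseudoinverse of $M$. The estimate after $t$ iterations is $\hat{x}^t=[\hat{x}_1^t;\cdots;\hat{x}_K^t]$. **Theorem.** Run CoCoA with $\lambda=0$. Then the expected generalization error after the first iteration, as an element of $[0,+\infty]$, is $$\mathbb{E}\bigl[\|x-\hat{x}^1\|^2\bigr]=\sum_{k=1}^K\|x_k\|^2\,\alpha_k,\qquad \alpha_k=\frac1{K^2}\Bigl(K^2+(1-2K)\frac{r_{\min,k}}{p_k}+\sum_{\substack{i=1\\ i\ne k}}^K\gamma_i\Bigr),$$ where $r_{\min,k}=\min\{p_k,n\}$, $r_{\max,k}=\max\{p_k,n\}$, and $$\gamma_k=\begin{cases}\dfrac{r_{\min,k}}{r_{\max,k}-r_{\min,k}-1} & \text{if } p_k\notin\{n-1,n,n+1\},\\[2mm] +\infty & \text{if } p_k\in\{n-1,n,n+1\},\end{cases}$$ with the convention $0\cdot(+\infty)=0$. -/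

import Mathlib

open MeasureTheory ProbabilityTheory Matrix
open scoped ENNReal

noncomputable section

namespace CoCoA

/-! ### The Moore-Penrose pseudoinverse of a real matrix -/

/-- The four Penrose conditions: `B` is a Moore-Penrose pseudoinverse of `A`. -/
structure IsMoorePenrose {m n : Type*} [Fintype m] [Fintype n]
    (A : Matrix m n ℝ) (B : Matrix n m ℝ) : Prop where
  mul_mul_self : A * B * A = A
  mul_mul_inv : B * A * B = B
  left_symm : (A * B)ᵀ = A * B
  right_symm : (B * A)ᵀ = B * A

/-- A Moore-Penrose pseudoinverse is unique. -/
theorem IsMoorePenrose.unique {m n : Type*} [Fintype m] [Fintype n]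
    {A : Matrix m n ℝ} {B C : Matrix n m ℝ}
    (hB : IsMoorePenrose A B) (hC : IsMoorePenrose A C) : B = C := by
  have hAB : A * B = A * C := by
    calc A * B = (A * C * A) * B := by rw [hC.mul_mul_self]
      _ = (A * C)ᵀ * (A * B)ᵀ := by
        rw [hC.left_symm, hB.left_symm]; simp only [Matrix.mul_assoc]
      _ = ((A * B * A) * C)ᵀ := by
        rw [← Matrix.transpose_mul]; simp only [Matrix.mul_assoc]
      _ = A * C := by rw [hB.mul_mul_self, hC.left_symm]
  have hBA : B * A = C * A := by
    calc B * A = B * (A * C * A) := by rw [hC.mul_mul_self]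
      _ = (B * A)ᵀ * (C * A)ᵀ := by
        rw [hC.right_symm, hB.right_symm]; simp only [Matrix.mul_assoc]
      _ = (C * (A * B * A))ᵀ := by
        rw [← Matrix.transpose_mul]; simp only [Matrix.mul_assoc]
      _ = C * A := by rw [hB.mul_mul_self, hC.right_symm]
  calc B = B * A * B := hB.mul_mul_inv.symm
    _ = C * A * C := by rw [hBA, Matrix.mul_assoc, hAB, ← Matrix.mul_assoc]
    _ = C := hC.mul_mul_inv

/-- A real symmetric matrix has a symmetric Moore-Penrose pseudoinverse commuting with it. -/
theorem exists_symm_pinv {n : Type*} [Fintype n] (G : Matrix n n ℝ) (hG : Gᵀ = G) :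
    ∃ P : Matrix n n ℝ, Pᵀ = P ∧ G * P * G = G ∧ P * G * P = P ∧ P * G = G * P := by
  classical
  have hH : G.IsHermitian := by
    rw [Matrix.IsHermitian, Matrix.conjTranspose_eq_transpose_of_trivial, hG]
  obtain ⟨U, d, hUU, hGU⟩ : ∃ (U : Matrix n n ℝ) (d : n → ℝ),
      Uᵀ * U = 1 ∧ G = U * diagonal d * Uᵀ := by
    refine ⟨(hH.eigenvectorUnitary : Matrix n n ℝ), hH.eigenvalues, ?_, ?_⟩
    · have := Unitary.coe_star_mul_self hH.eigenvectorUnitary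
      rwa [Matrix.star_eq_conjTranspose, Matrix.conjTranspose_eq_transpose_of_trivial] at this
    · have h := hH.spectral_theorem
      rw [Unitary.conjStarAlgAut_apply, Matrix.star_eq_conjTranspose,
        Matrix.conjTranspose_eq_transpose_of_trivial] at h
      exact h
  have key : ∀ e f : n → ℝ, (U * diagonal e * Uᵀ) * (U * diagonal f * Uᵀ)
      = U * diagonal (fun i => e i * f i) * Uᵀ := by
    intro e f
    calc (U * diagonal e * Uᵀ) * (U * diagonal f * Uᵀ)
        = U * diagonal e * (Uᵀ * U) * diagonal f * Uᵀ := by simp only [Matrix.mul_assoc]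
      _ = U * (diagonal e * diagonal f) * Uᵀ := by
        rw [hUU, Matrix.mul_one]; simp only [Matrix.mul_assoc]
      _ = _ := by rw [Matrix.diagonal_mul_diagonal]
  refine ⟨U * diagonal (fun i => (d i)⁻¹) * Uᵀ, ?_, ?_, ?_, ?_⟩
  · simp [Matrix.transpose_mul, Matrix.mul_assoc]
  · rw [hGU, key, key]
    congr 3
    funext i
    exact mul_inv_mul_cancel (d i)
  · rw [hGU, key, key]
    congr 3
    funext i
    by_cases h : d i = 0
    · simp [h]
    · field_simp
  · rw [hGU, key, key]
    congr 3
    funext i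
    exact mul_comm _ _

/-- Every real matrix has a Moore-Penrose pseudoinverse. -/
theorem exists_isMoorePenrose {m n : Type*} [Fintype m] [Fintype n] (A : Matrix m n ℝ) :
    ∃ B : Matrix n m ℝ, IsMoorePenrose A B := by
  classical
  obtain ⟨P, hPt, hGPG, hPGP, hcomm⟩ := exists_symm_pinv (Aᵀ * A)
    (by rw [Matrix.transpose_mul, Matrix.transpose_transpose])
  have hz : A * (P * (Aᵀ * A) - 1) = 0 := by
    apply Matrix.conjTranspose_mul_self_eq_zero.mp
    rw [Matrix.conjTranspose_eq_transpose_of_trivial, Matrix.transpose_mul]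
    have : (Aᵀ * A) * (P * (Aᵀ * A) - 1) = 0 := by
      rw [Matrix.mul_sub, Matrix.mul_one, ← Matrix.mul_assoc, hGPG, sub_self]
    calc (P * (Aᵀ * A) - 1)ᵀ * Aᵀ * (A * (P * (Aᵀ * A) - 1))
        = (P * (Aᵀ * A) - 1)ᵀ * ((Aᵀ * A) * (P * (Aᵀ * A) - 1)) := by
          simp only [Matrix.mul_assoc]
      _ = 0 := by rw [this, Matrix.mul_zero]
  refine ⟨P * Aᵀ, ?_, ?_, ?_, ?_⟩
  · rw [Matrix.mul_sub, Matrix.mul_one, sub_eq_zero] at hz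
    simpa only [Matrix.mul_assoc] using hz
  · calc P * Aᵀ * A * (P * Aᵀ) = (P * (Aᵀ * A) * P) * Aᵀ := by simp only [Matrix.mul_assoc]
      _ = P * Aᵀ := by rw [hPGP]
  · simp only [Matrix.transpose_mul, Matrix.transpose_transpose, hPt, Matrix.mul_assoc]
  · rw [Matrix.mul_assoc, Matrix.transpose_mul, Matrix.transpose_mul,
      Matrix.transpose_transpose, hPt, hcomm]

/-- The Moore-Penrose pseudoinverse `A⁺`. -/
def pinv {m n : Type*} [Fintype m] [Fintype n] (A : Matrix m n ℝ) : Matrix n m ℝ :=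
  (exists_isMoorePenrose A).choose

theorem pinv_spec {m n : Type*} [Fintype m] [Fintype n] (A : Matrix m n ℝ) :
    IsMoorePenrose A (pinv A) :=
  (exists_isMoorePenrose A).choose_spec

/-! ### Partitioned unknowns and the linear model

The `p = ∑ k, p k` unknowns are indexed by pairs `⟨k, j⟩`, the `j`-th unknown of node `k`. -/

/-- The index set of the unknowns. -/
abbrev Idx {K : ℕ} (p : Fin K → ℕ) : Type := Σ k : Fin K, Fin (p k)

/-- The column block `A_k`. -/
def colBlock {n K : ℕ} {p : Fin K → ℕ} (A : Matrix (Fin n) (Idx p) ℝ) (k : Fin K) :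
    Matrix (Fin n) (Fin (p k)) ℝ :=
  Matrix.of fun i j => A i ⟨k, j⟩

/-- The part `x_k` of the vector `x`, with the Euclidean norm. -/
def vecBlock {K : ℕ} {p : Fin K → ℕ} (x : EuclideanSpace ℝ (Idx p)) (k : Fin K) :
    EuclideanSpace ℝ (Fin (p k)) :=
  WithLp.toLp 2 fun j => x ⟨k, j⟩

/-- The regressor matrix `A` with rows `a_i`. -/
def regressorMatrix {n K : ℕ} {p : Fin K → ℕ} (a : Fin n → EuclideanSpace ℝ (Idx p)) :
    Matrix (Fin n) (Idx p) ℝ :=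
  Matrix.of fun i j => a i j

/-- The observations `y = A x + w`. -/
def observations {n K : ℕ} {p : Fin K → ℕ} (A : Matrix (Fin n) (Idx p) ℝ)
    (x : EuclideanSpace ℝ (Idx p)) (w : Fin n → ℝ) : Fin n → ℝ :=
  A *ᵥ x.ofLp + w

/-! ### The algorithm -/

/-- The variables of the algorithm in one iteration: each node `k` holds its part `xhat k` of the
estimate of `x` and its local estimate `v k` of `y`. -/
structure State (n : ℕ) {K : ℕ} (p : Fin K → ℕ) where
  xhat : (k : Fin K) → Fin (p k) → ℝ
  v : Fin K → Fin n → ℝ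

/-- Initialization: all the variables are zero. -/
def initState (n : ℕ) {K : ℕ} (p : Fin K → ℕ) : State n p where
  xhat := 0
  v := 0

/-- The average of the local estimates of `y`. -/
def State.vbar {n K : ℕ} {p : Fin K → ℕ} (s : State n p) : Fin n → ℝ :=
  (1 / (K : ℝ)) • ∑ k, s.v k

/-- The update computed by node `k`:
`Δx_k = -(K A_kᵀ A_k + lam I)⁺ (lam xhat_k - A_kᵀ (y - vbar))`. -/
def localUpdate {n K : ℕ} {p : Fin K → ℕ} (lam : ℝ) (A : Matrix (Fin n) (Idx p) ℝ)
    (y : Fin n → ℝ) (s : State n p) (k : Fin K) : Fin (p k) → ℝ :=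
  -(pinv ((K : ℝ) • ((colBlock A k)ᵀ * colBlock A k) + lam • (1 : Matrix (Fin (p k)) (Fin (p k)) ℝ))
    *ᵥ (lam • s.xhat k - (colBlock A k)ᵀ *ᵥ (y - s.vbar)))

/-- One iteration of CoCoA with regularization parameter `lam`. -/
def step {n K : ℕ} {p : Fin K → ℕ} (lam : ℝ) (A : Matrix (Fin n) (Idx p) ℝ)
    (y : Fin n → ℝ) (s : State n p) : State n p where
  xhat k := s.xhat k + localUpdate lam A y s k
  v k := s.vbar + (K : ℝ) • (colBlock A k *ᵥ localUpdate lam A y s k)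

/-- The state after `t` iterations of CoCoA. -/
def run {n K : ℕ} {p : Fin K → ℕ} (lam : ℝ) (A : Matrix (Fin n) (Idx p) ℝ)
    (y : Fin n → ℝ) : ℕ → State n p
  | 0 => initState n p
  | t + 1 => step lam A y (run lam A y t)

/-- The CoCoA estimate of `x` after `t` iterations. -/
def estimate {n K : ℕ} {p : Fin K → ℕ} (lam : ℝ) (A : Matrix (Fin n) (Idx p) ℝ)
    (y : Fin n → ℝ) (t : ℕ) : EuclideanSpace ℝ (Idx p) :=
  WithLp.toLp 2 fun j => (run lam A y t).xhat j.1 j.2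

/-! ### The error and the constants -/

/-- The expectation `E ‖x - xhat‖²` over the training data, with values in `[0, ∞]`. -/
def generalizationError {Ω : Type*} [MeasurableSpace Ω] (P : Measure Ω) {K : ℕ} {p : Fin K → ℕ}
    (x : EuclideanSpace ℝ (Idx p)) (xhat : Ω → EuclideanSpace ℝ (Idx p)) : ℝ≥0∞ :=
  ∫⁻ ω, ENNReal.ofReal (‖x - xhat ω‖ ^ 2) ∂P

/-- The constant `γ` of a node with `q` unknowns, for `n` observations. -/
def gamma (n q : ℕ) : EReal :=
  if q + 1 = n ∨ q = n ∨ q = n + 1 then ⊤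
  else ((((min q n : ℕ) : ℝ) / (((max q n : ℕ) : ℝ) - ((min q n : ℕ) : ℝ) - 1) : ℝ) : EReal)

/-- The constant `α_k`. -/
def alpha (n : ℕ) {K : ℕ} (p : Fin K → ℕ) (k : Fin K) : EReal :=
  ((1 / (K : ℝ) ^ 2 : ℝ) : EReal) *
    ((((K : ℝ) ^ 2 + (1 - 2 * (K : ℝ)) * (((min (p k) n : ℕ) : ℝ) / (p k : ℝ)) : ℝ) : EReal)
      + ∑ i ∈ Finset.univ.erase k, gamma n (p i))

end CoCoA

end

namespace CoCoA

/-! ### Algebra of the pseudoinverse and the first CoCoA iterate -/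

section Pinv

variable {m n : Type*} [Fintype m] [Fintype n]

/-! Started at zero with `lam = 0`, one step gives block `k` the estimate `c • A_k⁺ y` with `c =
1/K` (`estimate_one_apply`). Splitting `y = A_k x_k + z`, where `z` collects the other columns, the
error of the block is `x_k - c Π x_k - c A_k⁺ z`, with `Π = A_k⁺ A_k` the orthogonal projection onto
the row space of `A_k`. Given `A_k`, the vector `z` is centred Gaussian with covariance `(∑_{i ≠ k}
‖x_i‖²) I`, so the cross term vanishes and two expectations remain (`lintegral_blockError`).

The first is that of `x_k ⬝ Π x_k`: the row space is rotation invariant and has dimension `min p_k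
n` almost surely, which gives `‖x_k‖² min(p_k, n) / p_k` (`integral_pinv_mul_quadratic`).

The second is that of the squared Frobenius norm of `A_k⁺`, which is `γ_k` (`lintegral_pinv_sq`). Up
to transposition it is the trace of an inverse Gram matrix. Each diagonal entry of that inverse is
the inverse squared distance of one Gaussian vector to the span of the others, an inverse
chi-squared variable; its mean is infinite exactly when at most two degrees of freedom remain.

Exchanging the double sum over `k ≠ i` then moves `γ_i` into `α_k` (`sum_error_eq`). -/

theorem pinv_eq {A : Matrix m n ℝ} {B : Matrix n m ℝ} (h : IsMoorePenrose A B) : pinv A = B :=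
  (pinv_spec A).unique h

theorem pinv_transpose (A : Matrix m n ℝ) : pinv Aᵀ = (pinv A)ᵀ := by
  have h := pinv_spec A
  refine pinv_eq ⟨?_, ?_, ?_, ?_⟩
  · rw [← transpose_mul, ← transpose_mul, ← Matrix.mul_assoc, h.mul_mul_self]
  · rw [← transpose_mul, ← transpose_mul, ← Matrix.mul_assoc, h.mul_mul_inv]
  · rw [← transpose_mul, h.right_symm, h.right_symm]
  · rw [← transpose_mul, h.left_symm, h.left_symm]

/-- Multiplied by `Aᵀ * A` on either side, the candidate collapses to the symmetric projection `pinv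
A * A`; the Penrose conditions follow. -/
theorem pinv_mul_pinv_transpose (A : Matrix m n ℝ) :
    pinv (Aᵀ * A) = pinv A * (pinv A)ᵀ := by
  have h := pinv_spec A
  have h1 : Aᵀ * A * (pinv A * (pinv A)ᵀ) = pinv A * A := by
    calc Aᵀ * A * (pinv A * (pinv A)ᵀ) = Aᵀ * (A * pinv A)ᵀ * (pinv A)ᵀ := by
          rw [h.left_symm]; simp only [Matrix.mul_assoc]
      _ = (pinv A * (A * pinv A * A))ᵀ := by simp only [transpose_mul, Matrix.mul_assoc]
      _ = pinv A * A := by rw [h.mul_mul_self, h.right_symm]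
  have h2 : pinv A * (pinv A)ᵀ * (Aᵀ * A) = pinv A * A := by
    calc pinv A * (pinv A)ᵀ * (Aᵀ * A) = pinv A * (A * pinv A)ᵀ * A := by
          simp only [transpose_mul, Matrix.mul_assoc]
      _ = pinv A * A := by rw [h.left_symm, ← Matrix.mul_assoc, h.mul_mul_inv]
  refine pinv_eq ⟨?_, ?_, ?_, ?_⟩
  · calc Aᵀ * A * (pinv A * (pinv A)ᵀ) * (Aᵀ * A)
        = Aᵀ * A * (pinv A * (pinv A)ᵀ * (Aᵀ * A)) := by simp only [Matrix.mul_assoc]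
      _ = Aᵀ * (A * pinv A * A) := by rw [h2]; simp only [Matrix.mul_assoc]
      _ = Aᵀ * A := by rw [h.mul_mul_self]
  · rw [h2, ← Matrix.mul_assoc, h.mul_mul_inv]
  · rw [h1, h.right_symm]
  · rw [h2, h.right_symm]

theorem pinv_gram_mul_transpose (A : Matrix m n ℝ) : pinv (Aᵀ * A) * Aᵀ = pinv A := by
  have h := pinv_spec A
  rw [pinv_mul_pinv_transpose, Matrix.mul_assoc, ← transpose_mul, h.left_symm,
    ← Matrix.mul_assoc, h.mul_mul_inv]

theorem pinv_smul {c : ℝ} (hc : c ≠ 0) (A : Matrix m n ℝ) : pinv (c • A) = c⁻¹ • pinv A := by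
  have h := pinv_spec A
  refine pinv_eq ⟨?_, ?_, ?_, ?_⟩ <;>
    simp [smul_smul, hc, h.mul_mul_self, h.mul_mul_inv, h.left_symm, h.right_symm]

/-- Source of the rotation equivariance of the row space projection `pinv A * A`. -/
theorem pinv_mul_orthogonal [DecidableEq n] (A : Matrix m n ℝ) {O : Matrix n n ℝ}
    (hO : O * Oᵀ = 1) : pinv (A * O) = Oᵀ * pinv A := by
  have h := pinv_spec A
  have h1 : A * O * (Oᵀ * pinv A) = A * pinv A := by
    rw [Matrix.mul_assoc, ← Matrix.mul_assoc O, hO, Matrix.one_mul]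
  refine pinv_eq ⟨?_, ?_, ?_, ?_⟩
  · rw [h1, ← Matrix.mul_assoc, h.mul_mul_self]
  · rw [Matrix.mul_assoc, h1, Matrix.mul_assoc, ← Matrix.mul_assoc (pinv A), h.mul_mul_inv]
  · rw [h1, h.left_symm]
  · rw [← Matrix.mul_assoc, Matrix.mul_assoc Oᵀ, transpose_mul, transpose_mul, h.right_symm,
      transpose_transpose, ← Matrix.mul_assoc]

variable [DecidableEq m] {A : Matrix m n ℝ}

theorem pinv_eq_of_isUnit_det (hA : IsUnit (A * Aᵀ).det) : pinv A = Aᵀ * (A * Aᵀ)⁻¹ := by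
  have h1 : A * (Aᵀ * (A * Aᵀ)⁻¹) = 1 := by
    rw [← Matrix.mul_assoc, Matrix.mul_nonsing_inv _ hA]
  refine pinv_eq ⟨?_, ?_, ?_, ?_⟩
  · rw [h1, Matrix.one_mul]
  · rw [Matrix.mul_assoc, h1, Matrix.mul_one]
  · rw [h1, transpose_one]
  · simp only [transpose_mul, transpose_transpose, transpose_nonsing_inv, Matrix.mul_assoc]

theorem mul_pinv_of_isUnit_det (hA : IsUnit (A * Aᵀ).det) : A * pinv A = 1 := by
  rw [pinv_eq_of_isUnit_det hA, ← Matrix.mul_assoc, Matrix.mul_nonsing_inv _ hA]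

theorem transpose_pinv_mul_pinv_of_isUnit_det (hA : IsUnit (A * Aᵀ).det) :
    (pinv A)ᵀ * pinv A = (A * Aᵀ)⁻¹ := by
  rw [pinv_eq_of_isUnit_det hA]
  simp only [transpose_mul, transpose_transpose, transpose_nonsing_inv]
  rw [Matrix.mul_assoc, ← Matrix.mul_assoc A, Matrix.mul_nonsing_inv _ hA, Matrix.mul_one]

end Pinv

theorem sum_sq_eq_trace {m n : Type*} [Fintype m] [Fintype n] (B : Matrix n m ℝ) :
    ∑ j, ∑ i, B j i ^ 2 = (Bᵀ * B).trace := by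
  simp only [trace, diag_apply, mul_apply, transpose_apply, ← sq]
  exact Finset.sum_comm

theorem estimate_one_apply {n K : ℕ} {p : Fin K → ℕ} (A : Matrix (Fin n) (Idx p) ℝ)
    (y : Fin n → ℝ) (j : Idx p) :
    estimate 0 A y 1 j = (K : ℝ)⁻¹ * (pinv (colBlock A j.1) *ᵥ y) j.2 := by
  have hK : (K : ℝ) ≠ 0 := by
    -- The index `j` itself names a node, so there is at least one.
    have := j.1.pos
    positivity
  simp [estimate, run, step, localUpdate, initState, State.vbar, mulVec_neg, pinv_smul hK,
    mulVec_mulVec, pinv_gram_mul_transpose, smul_mulVec]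

end CoCoA

namespace CoCoA

/-! ### Inverse moment of the squared norm of a Gaussian vector -/

section NegativeMoment

theorem integral_exp_sq_gaussianReal {s : ℝ} (hs : 0 < s) :
    ∫ x, Real.exp (-(s - 1) * x ^ 2 / 2) ∂(gaussianReal 0 1) = s ^ (-(1 / 2) : ℝ) := by
  rw [integral_gaussianReal_eq_integral_smul one_ne_zero]
  have h : ∀ x : ℝ, gaussianPDFReal 0 1 x • Real.exp (-(s - 1) * x ^ 2 / 2)
      = (√(2 * Real.pi))⁻¹ * Real.exp (-(s / 2) * x ^ 2) := by
    intro x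
    rw [gaussianPDFReal, smul_eq_mul, mul_assoc, ← Real.exp_add]
    simp only [NNReal.coe_one, mul_one, sub_zero]
    congr 2
    ring
  simp_rw [h]
  rw [integral_const_mul, integral_gaussian, ← Real.sqrt_inv, ← Real.sqrt_mul (by positivity),
    Real.rpow_neg hs.le, ← Real.sqrt_eq_rpow, ← Real.sqrt_inv]
  congr 1
  field_simp

variable (V : Type*) [NormedAddCommGroup V] [InnerProductSpace ℝ V] [FiniteDimensional ℝ V]
  [MeasurableSpace V] [BorelSpace V]

/-- Laplace transform of the chi-squared law: in an orthonormal basis the integrand is a product of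
one-dimensional Gaussian integrals. -/
theorem lintegral_exp_norm_sq_stdGaussian {s : ℝ} (hs : 1 < s) :
    ∫⁻ v : V, ENNReal.ofReal (Real.exp (-(s - 1) * ‖v‖ ^ 2 / 2)) ∂stdGaussian V
      = ENNReal.ofReal (s ^ (-(Module.finrank ℝ V / 2) : ℝ)) := by
  have hs0 : 0 < s := by linarith
  have hm : Measurable fun v : V => Real.exp (-(s - 1) * ‖v‖ ^ 2 / 2) := by fun_prop
  rw [← ofReal_integral_eq_lintegral_ofReal]
  · congr 1
    rw [stdGaussian_eq_map_pi_orthonormalBasis (stdOrthonormalBasis ℝ V),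
      integral_map (Measurable.aemeasurable (by fun_prop)) hm.aestronglyMeasurable]
    have h : ∀ x : Fin (Module.finrank ℝ V) → ℝ,
        Real.exp (-(s - 1) * ‖∑ i, x i • stdOrthonormalBasis ℝ V i‖ ^ 2 / 2)
          = ∏ i, Real.exp (-(s - 1) * x i ^ 2 / 2) := by
      intro x
      rw [← Real.exp_sum, ← (stdOrthonormalBasis ℝ V).sum_sq_inner_right]
      congr 1
      simp_rw [inner_sum, real_inner_smul_right, orthonormal_iff_ite.mp
        (stdOrthonormalBasis ℝ V).orthonormal]
      simp [Finset.mul_sum, Finset.sum_div]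
    simp_rw [h]
    rw [integral_fintype_prod_eq_pow (f := fun y : ℝ => Real.exp (-(s - 1) * y ^ 2 / 2)),
      integral_exp_sq_gaussianReal hs0, Fintype.card_fin, ← Real.rpow_natCast,
      ← Real.rpow_mul hs0.le]
    congr 1
    ring
  · refine Integrable.of_bound hm.aestronglyMeasurable 1 (ae_of_all _ fun v => ?_)
    rw [Real.norm_eq_abs, Real.abs_exp, Real.exp_le_one_iff]
    have := sq_nonneg ‖v‖
    nlinarith
  · exact ae_of_all _ fun v => (Real.exp_pos _).le

/-- Represents `1/r` by exponentials, whose Gaussian expectations are explicit. At `r = 0` both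
sides are infinite. -/
theorem lintegral_exp_Ioi_one {r : ℝ} (hr : 0 ≤ r) :
    ∫⁻ s in Set.Ioi (1 : ℝ), ENNReal.ofReal (Real.exp (-(s - 1) * r / 2))
      = 2 * (ENNReal.ofReal r)⁻¹ := by
  rcases hr.eq_or_lt with rfl | hr
  · simp
  have h : ∀ s : ℝ, Real.exp (-(s - 1) * r / 2) = Real.exp (r / 2) * Real.exp (-(r / 2) * s) := by
    intro s
    rw [← Real.exp_add]
    congr 1
    ring
  simp_rw [h]
  have hr2 : -(r / 2) < 0 := by linarith
  rw [← ofReal_integral_eq_lintegral_ofReal ((integrableOn_exp_mul_Ioi hr2 1).const_mul _)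
    (ae_of_all _ fun v => by positivity), integral_const_mul, integral_exp_mul_Ioi hr2,
    ← ENNReal.ofReal_inv_of_pos hr, ← ENNReal.ofReal_ofNat 2,
    ← ENNReal.ofReal_mul (by norm_num)]
  congr 1
  rw [neg_div_neg_eq, mul_one, mul_div_assoc', ← Real.exp_add]
  field_simp
  simp

theorem lintegral_rpow_Ioi_one (d : ℕ) :
    ∫⁻ s in Set.Ioi (1 : ℝ), ENNReal.ofReal (s ^ (-(d / 2) : ℝ))
      = if d ≤ 2 then ⊤ else 2 * ENNReal.ofReal (1 / ((d : ℝ) - 2)) := by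
  have hpos : 0 ≤ᵐ[volume.restrict (Set.Ioi (1 : ℝ))] fun s : ℝ => s ^ (-(d / 2) : ℝ) :=
    (ae_restrict_mem measurableSet_Ioi).mono fun s hs =>
      Real.rpow_nonneg (zero_le_one.trans (Set.mem_Ioi.mp hs).le) _
  split_ifs with h
  · by_contra hne
    have hint : IntegrableOn (fun s : ℝ => s ^ (-(d / 2) : ℝ)) (Set.Ioi 1) := by
      refine (lintegral_ofReal_ne_top_iff_integrable ?_ hpos).mp hne
      exact (by fun_prop : Measurable fun s : ℝ => s ^ (-(d / 2) : ℝ)).aestronglyMeasurable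
    rw [integrableOn_Ioi_rpow_iff one_pos] at hint
    have : (d : ℝ) ≤ 2 := by exact_mod_cast h
    linarith
  · have hd : (2 : ℝ) < d := by exact_mod_cast not_le.mp h
    have hlt : -(d / 2 : ℝ) < -1 := by linarith
    rw [← ofReal_integral_eq_lintegral_ofReal (integrableOn_Ioi_rpow_of_lt hlt one_pos) hpos,
      integral_Ioi_rpow_of_lt hlt one_pos, ← ENNReal.ofReal_ofNat 2,
      ← ENNReal.ofReal_mul (by norm_num), Real.one_rpow]
    congr 1
    have h2 : (d : ℝ) - 2 ≠ 0 := by linarith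
    rw [show -(d / 2 : ℝ) + 1 = -(((d : ℝ) - 2) / 2) by ring, neg_div_neg_eq]
    field_simp

/-- The expectation of the inverse of a chi-squared variable. -/
theorem lintegral_inv_norm_sq_stdGaussian :
    ∫⁻ v : V, (ENNReal.ofReal (‖v‖ ^ 2))⁻¹ ∂stdGaussian V
      = if Module.finrank ℝ V ≤ 2 then ⊤
        else ENNReal.ofReal (1 / ((Module.finrank ℝ V : ℝ) - 2)) := by
  have h2 : ∫⁻ v : V, 2 * (ENNReal.ofReal (‖v‖ ^ 2))⁻¹ ∂stdGaussian V
      = if Module.finrank ℝ V ≤ 2 then ⊤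
        else 2 * ENNReal.ofReal (1 / ((Module.finrank ℝ V : ℝ) - 2)) := by
    -- Tonelli: after the swap the Gaussian integral is `s ^ (-d/2)`, whose integral over `s > 1`
    -- diverges exactly for `d ≤ 2`.
    simp_rw [← lintegral_exp_Ioi_one (sq_nonneg ‖_‖)]
    rw [lintegral_lintegral_swap (by fun_prop), ← lintegral_rpow_Ioi_one]
    exact setLIntegral_congr_fun measurableSet_Ioi fun s hs =>
      lintegral_exp_norm_sq_stdGaussian V hs
  rw [lintegral_const_mul _ (by fun_prop)] at h2
  refine (ENNReal.mul_right_inj two_ne_zero ENNReal.ofNat_ne_top).mp (h2.trans ?_)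
  split_ifs
  · rw [ENNReal.mul_top two_ne_zero]
  · rfl

end NegativeMoment

/-! ### Projections and null subspaces of the standard Gaussian -/

section StdGaussian

variable {E : Type*} [NormedAddCommGroup E] [InnerProductSpace ℝ E] [FiniteDimensional ℝ E]
  [MeasurableSpace E] [BorelSpace E]

/-- For `t` in `W`, pairing with `t` does not see the projection, and the characteristic function
depends only on `‖t‖`. -/
theorem stdGaussian_map_orthogonalProjectionOnto (W : Submodule ℝ E) :
    (stdGaussian E).map W.orthogonalProjectionOnto = stdGaussian W := by
  apply Measure.ext_of_charFun
  ext t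
  rw [charFun_stdGaussian, charFun_apply, integral_map (by fun_prop) (by fun_prop)]
  simp_rw [Submodule.inner_orthogonalProjectionOnto_eq_of_mem_right]
  rw [← charFun_apply, charFun_stdGaussian, Submodule.coe_norm]

/-- A proper subspace lies in the kernel of some `⟪u, ·⟫` with `u ≠ 0`, whose law is a nondegenerate
real Gaussian. -/
theorem stdGaussian_submodule_eq_zero {W : Submodule ℝ E} (hW : W ≠ ⊤) :
    stdGaussian E (W : Set E) = 0 := by
  obtain ⟨u, hu, hu0⟩ := Submodule.exists_mem_ne_zero_of_ne_bot
    (mt Submodule.orthogonal_eq_bot_iff.mp hW)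
  refine measure_mono_null (t := (innerSL ℝ u) ⁻¹' {0}) (fun w hw => ?_) ?_
  · simpa using Submodule.inner_left_of_mem_orthogonal hw hu
  · rw [← Measure.map_apply (by fun_prop) (measurableSet_singleton _),
      IsGaussian.map_eq_gaussianReal, variance_dual_stdGaussian, innerSL_apply_norm]
    have : NullSingletonClass (gaussianReal ((stdGaussian E)[innerSL ℝ u])
        (‖u‖ ^ 2).toNNReal) := by
      apply nullSingletonClass_gaussianReal
      rw [Ne, Real.toNNReal_eq_zero, not_le]
      positivity
    exact measure_singleton _

theorem lintegral_inv_norm_sq_starProjection (W : Submodule ℝ E) :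
    ∫⁻ v : E, (ENNReal.ofReal (‖W.starProjection v‖ ^ 2))⁻¹ ∂stdGaussian E
      = if Module.finrank ℝ W ≤ 2 then ⊤
        else ENNReal.ofReal (1 / ((Module.finrank ℝ W : ℝ) - 2)) := by
  rw [← lintegral_inv_norm_sq_stdGaussian, ← stdGaussian_map_orthogonalProjectionOnto,
    lintegral_map (by fun_prop) (by fun_prop)]
  rfl

end StdGaussian

end CoCoA

namespace CoCoA

/-! ### Inverse Gram matrices of independent Gaussian vectors -/

section Gram

variable {E : Type*} [NormedAddCommGroup E] [InnerProductSpace ℝ E] [FiniteDimensional ℝ E]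

/-- Row `j` of the inverse Gram matrix gives the dual vector `b`, orthogonal to every `c i` with `i
≠ j` and pairing to `1` with `c j`. Projection onto `Wᗮ` fixes `b` and kills all its terms but the
`j`-th; pairing the result with `c j` gives the identity. -/
theorem gram_inv_diag_mul_norm_sq {k : ℕ} {c : Fin (k + 1) → E} (hc : LinearIndependent ℝ c)
    (j : Fin (k + 1)) :
    (gram ℝ c)⁻¹ j j * ‖(Submodule.span ℝ (Set.range fun i => c (j.succAbove i)))ᗮ.starProjection
      (c j)‖ ^ 2 = 1 := by
  set W := Submodule.span ℝ (Set.range fun i => c (j.succAbove i)) with hW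
  set B := (gram ℝ c)⁻¹
  have hdet : IsUnit (gram ℝ c).det := (det_gram_ne_zero_iff_linearIndependent.mpr hc).isUnit
  set b := ∑ i, B j i • c i with hb
  have hbc : ∀ i, inner ℝ b (c i) = if j = i then 1 else 0 := by
    intro i
    have h := congrFun (congrFun (Matrix.nonsing_inv_mul _ hdet) j) i
    rw [mul_apply, one_apply] at h
    rw [← h, hb, sum_inner]
    exact Finset.sum_congr rfl fun l _ => by rw [real_inner_smul_left, gram_apply]
  have hbW : b ∈ Wᗮ := by
    rw [Submodule.mem_orthogonal']
    intro w hw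
    induction hw using Submodule.span_induction with
    | mem x hx =>
      obtain ⟨i, rfl⟩ := hx
      rw [hbc, if_neg (Fin.succAbove_ne j i).symm]
    | zero => exact inner_zero_right _
    | add x y _ _ hx hy => rw [inner_add_right, hx, hy, add_zero]
    | smul a x _ hx => rw [inner_smul_right, hx, mul_zero]
  have hPb : Wᗮ.starProjection b = B j j • Wᗮ.starProjection (c j) := by
    rw [hb, map_sum, Finset.sum_eq_single j]
    · rw [map_smul]
    · intro i _ hij
      obtain ⟨l, rfl⟩ := Fin.exists_succAbove_eq hij
      rw [map_smul, Submodule.starProjection_orthogonal_apply_eq_zero, smul_zero]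
      exact Submodule.subset_span ⟨l, rfl⟩
    · simp
  have h1 : inner ℝ (Wᗮ.starProjection b) (c j) = (1 : ℝ) := by
    rw [Submodule.starProjection_eq_self_iff.mpr hbW, hbc, if_pos rfl]
  rw [hPb, real_inner_smul_left] at h1
  have h2 := Submodule.re_inner_starProjection_eq_normSq (K := Wᗮ) (c j)
  simp only [RCLike.re_to_real] at h2
  rw [← h1, h2]
  rfl

variable [MeasurableSpace E] [BorelSpace E]

theorem measurable_gram_inv_apply {q : ℕ} (i j : Fin q) :
    Measurable fun c : Fin q → E => (gram ℝ c)⁻¹ i j := by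
  have hcont : Continuous fun c : Fin q → E => gram ℝ c :=
    continuous_matrix fun i j => by
      simp only [gram_apply]
      fun_prop
  simp only [inv_def, Ring.inverse_eq_inv', Matrix.smul_apply, smul_eq_mul]
  exact hcont.matrix_det.measurable.inv.mul (hcont.matrix_adjugate.matrix_elem i j).measurable

theorem measurableSet_linearIndependent (q : ℕ) :
    MeasurableSet {c : Fin q → E | LinearIndependent ℝ c} := by
  have hcont : Continuous fun c : Fin q → E => gram ℝ c :=
    continuous_matrix fun i j => by
      simp only [gram_apply]
      fun_prop
  simp_rw [← det_gram_ne_zero_iff_linearIndependent]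
  exact (measurableSet_singleton (0 : ℝ)).compl.preimage hcont.matrix_det.measurable

/-- By induction: the span of fewer than `finrank ℝ E` vectors is proper, so an independent Gaussian
vector almost surely avoids it. -/
theorem ae_linearIndependent {q : ℕ} (hq : q ≤ Module.finrank ℝ E) :
    ∀ᵐ c ∂Measure.pi (fun _ : Fin q => stdGaussian E), LinearIndependent ℝ c := by
  induction q with
  | zero => exact ae_of_all _ fun c => linearIndependent_empty_type
  | succ k ih =>
    have hmp := measurePreserving_piFinSuccAbove (fun _ : Fin (k + 1) => stdGaussian E) 0
    rw [← hmp.symm.map_eq, ae_map_iff (MeasurableEquiv.measurable _).aemeasurable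
      (measurableSet_linearIndependent _)]
    have hswap : ∀ᵐ z ∂(Measure.pi fun _ : Fin k => stdGaussian E).prod (stdGaussian E),
        LinearIndependent ℝ ((MeasurableEquiv.piFinSuccAbove (fun _ : Fin (k + 1) => E) 0).symm
          z.swap) := by
      refine (Measure.ae_prod_iff_ae_ae ?_).mpr ?_
      · exact (measurableSet_linearIndependent _).preimage
          ((MeasurableEquiv.measurable _).comp measurable_swap)
      · filter_upwards [ih (by omega)] with w hw
        have hne : Submodule.span ℝ (Set.range w) ≠ ⊤ := by
          intro h
          have := finrank_span_eq_card hw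
          rw [h, finrank_top, Fintype.card_fin] at this
          omega
        have hnull := stdGaussian_submodule_eq_zero hne
        filter_upwards [compl_mem_ae_iff.mpr hnull] with x hx
        rw [Prod.swap_prod_mk, MeasurableEquiv.piFinSuccAbove_symm_apply,
          Fin.insertNthEquiv_zero]
        exact linearIndependent_finCons.mpr ⟨hw, hx⟩
    rw [← Measure.prod_swap, ae_map_iff measurable_swap.aemeasurable]
    · exact hswap
    · exact (measurableSet_linearIndependent _).preimage (MeasurableEquiv.measurable _)

/-- With the other `k` vectors fixed, the entry is the inverse squared norm of the projection of a
standard Gaussian onto `Wᗮ`, of dimension `finrank ℝ E - k`. -/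
theorem lintegral_gram_inv_diag {k : ℕ} (hk : k + 1 ≤ Module.finrank ℝ E) (j : Fin (k + 1)) :
    ∫⁻ c, ENNReal.ofReal ((gram ℝ c)⁻¹ j j) ∂Measure.pi (fun _ : Fin (k + 1) => stdGaussian E)
      = if Module.finrank ℝ E ≤ k + 2 then ⊤
        else ENNReal.ofReal (1 / ((Module.finrank ℝ E : ℝ) - k - 2)) := by
  have hmp := measurePreserving_piFinSuccAbove (fun _ : Fin (k + 1) => stdGaussian E) j
  have hli := ae_linearIndependent hk
  rw [← hmp.symm.map_eq] at hli
  replace hli := ae_of_ae_map (MeasurableEquiv.measurable _).aemeasurable hli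
  rw [← Measure.prod_swap] at hli
  replace hli := ae_of_ae_map measurable_swap.aemeasurable hli
  have hf : Measurable fun c : Fin (k + 1) → E => ENNReal.ofReal ((gram ℝ c)⁻¹ j j) :=
    (measurable_gram_inv_apply j j).ennreal_ofReal
  have hf' := hf.comp (MeasurableEquiv.piFinSuccAbove (fun _ : Fin (k + 1) => E) j).symm.measurable
  rw [← hmp.symm.lintegral_comp hf]
  refine (lintegral_prod_symm _ hf'.aemeasurable).trans ?_
  rw [← mul_one (ite _ _ _), ← measure_univ (μ := Measure.pi fun _ : Fin k => stdGaussian E),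
    ← lintegral_const]
  refine lintegral_congr_ae ?_
  filter_upwards [Measure.ae_ae_of_ae_prod hli, ae_linearIndependent
    (show k ≤ Module.finrank ℝ E by omega)] with w hw hwi
  set W := Submodule.span ℝ (Set.range w) with hW
  have hdim : Module.finrank ℝ Wᗮ + k = Module.finrank ℝ E := by
    rw [← W.finrank_add_finrank_orthogonal, hW, finrank_span_eq_card hwi, Fintype.card_fin,
      add_comm]
  have hdim' : (Module.finrank ℝ Wᗮ : ℝ) + k = Module.finrank ℝ E := by exact_mod_cast hdim
  have h := lintegral_inv_norm_sq_starProjection Wᗮ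
  rw [show (Module.finrank ℝ Wᗮ : ℝ) - 2 = Module.finrank ℝ E - k - 2 by linarith] at h
  simp only [show Module.finrank ℝ Wᗮ ≤ 2 ↔ Module.finrank ℝ E ≤ k + 2 by omega] at h
  rw [← h]
  refine lintegral_congr_ae ?_
  filter_upwards [hw] with x hx
  have h1 := gram_inv_diag_mul_norm_sq (c := j.insertNth (α := fun _ => E) x w) hx j
  simp only [Fin.insertNth_apply_same, Fin.insertNth_apply_succAbove] at h1
  replace h1 : (gram ℝ (j.insertNth (α := fun _ => E) x w))⁻¹ j j
    * ‖Wᗮ.starProjection x‖ ^ 2 = 1 := h1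
  change ENNReal.ofReal ((gram ℝ (j.insertNth (α := fun _ => E) x w))⁻¹ j j) = _
  -- A zero projection would contradict the product in `h1` being `1`.
  have hpos : 0 < ‖Wᗮ.starProjection x‖ ^ 2 := by
    refine lt_of_le_of_ne (sq_nonneg _) fun h0 => ?_
    rw [← h0, mul_zero] at h1
    exact zero_ne_one h1
  rw [← ENNReal.ofReal_inv_of_pos hpos, eq_inv_of_mul_eq_one_left h1]

theorem lintegral_trace_gram_inv {q : ℕ} (hq : q ≤ Module.finrank ℝ E) (hq0 : 0 < q) :
    ∫⁻ c, ENNReal.ofReal (gram ℝ c)⁻¹.trace ∂Measure.pi (fun _ : Fin q => stdGaussian E)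
      = if Module.finrank ℝ E ≤ q + 1 then ⊤
        else ENNReal.ofReal (q / ((Module.finrank ℝ E : ℝ) - q - 1)) := by
  obtain ⟨k, rfl⟩ := Nat.exists_eq_succ_of_ne_zero hq0.ne'
  have h : ∀ c : Fin (k + 1) → E, ENNReal.ofReal (gram ℝ c)⁻¹.trace
      = ∑ j, ENNReal.ofReal ((gram ℝ c)⁻¹ j j) := fun c =>
    ENNReal.ofReal_sum_of_nonneg fun j _ => (posSemidef_gram (𝕜 := ℝ) c).inv.diag_nonneg
  simp_rw [Nat.succ_eq_add_one, h]
  rw [lintegral_finsetSum _ fun j _ => (measurable_gram_inv_apply j j).ennreal_ofReal]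
  simp_rw [lintegral_gram_inv_diag hq]
  rw [Finset.sum_const, Finset.card_univ, Fintype.card_fin]
  split_ifs with h2
  · simp [ENNReal.mul_top]
  · have hlt : (k : ℝ) + 2 < Module.finrank ℝ E := by exact_mod_cast not_le.mp h2
    rw [nsmul_eq_mul, ← ENNReal.ofReal_natCast, ← ENNReal.ofReal_mul (by positivity)]
    congr 1
    push_cast
    rw [mul_one_div]
    congr 1
    ring

end Gram

end CoCoA

noncomputable section

namespace CoCoA

/-! ### Gaussian matrices by entries, by rows and by columns -/

section Laws

/-- The law of a family of independent standard normal variables. -/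
abbrev stdNormalPi (ι : Type*) [Fintype ι] : Measure (ι → ℝ) :=
  Measure.pi fun _ => gaussianReal 0 1

/-- The law of the rows of a matrix with independent standard normal entries. -/
abbrev gaussianRows (m n : Type*) [Fintype m] [Fintype n] : Measure (m → EuclideanSpace ℝ n) :=
  Measure.pi fun _ => stdGaussian (EuclideanSpace ℝ n)

/-- The matrix with given rows. -/
def rowMatrix {m n : Type*} (r : m → EuclideanSpace ℝ n) : Matrix m n ℝ :=
  Matrix.of fun i j => r i j

theorem gram_eq_rowMatrix_mul_transpose {m n : Type*} [Fintype n] (r : m → EuclideanSpace ℝ n) :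
    gram ℝ r = rowMatrix r * (rowMatrix r)ᵀ := by
  ext i j
  simp [gram_apply, rowMatrix, mul_apply, PiLp.inner_apply, mul_comm]

variable {m n ι κ : Type*} [Fintype m] [Fintype n] [Fintype ι] [Fintype κ]

theorem measurePreserving_entries :
    MeasurePreserving (fun (r : m → EuclideanSpace ℝ n) (ij : m × n) => r ij.1 ij.2)
      (gaussianRows m n) (stdNormalPi (m × n)) := by
  have hm : Measurable fun (r : m → EuclideanSpace ℝ n) (ij : m × n) => r ij.1 ij.2 := by
    fun_prop
  refine ⟨hm, (Measure.pi_eq fun s hs => ?_).symm⟩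
  have hpre : (fun (r : m → EuclideanSpace ℝ n) (ij : m × n) => r ij.1 ij.2) ⁻¹' Set.univ.pi s
      = Set.univ.pi fun i => {v : EuclideanSpace ℝ n | ∀ j, v j ∈ s (i, j)} := by
    ext r
    simp [Set.mem_pi, Prod.forall]
  rw [Measure.map_apply hm (MeasurableSet.univ_pi hs), hpre, Measure.pi_pi,
    Fintype.prod_prod_type]
  refine Finset.prod_congr rfl fun i _ => ?_
  rw [← map_pi_eq_stdGaussian, Measure.map_apply (by fun_prop)]
  · rw [← Measure.pi_pi]
    congr 1
    ext v
    simp [Set.mem_pi]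
  · simp only [Set.ofPred_forall]
    exact MeasurableSet.iInter fun j =>
      (hs (i, j)).preimage (by fun_prop : Measurable fun v : EuclideanSpace ℝ n => v j)

theorem measurePreserving_rows :
    MeasurePreserving (fun (X : m × n → ℝ) (i : m) => WithLp.toLp 2 fun j : n => X (i, j))
      (stdNormalPi (m × n)) (gaussianRows m n) := by
  have hm : Measurable fun (X : m × n → ℝ) (i : m) => WithLp.toLp 2 fun j : n => X (i, j) := by
    fun_prop
  refine ⟨hm, ?_⟩
  rw [← measurePreserving_entries.map_eq, Measure.map_map hm measurePreserving_entries.measurable]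
  exact Measure.map_id

theorem measurePreserving_comp_injective {f : κ → ι} (hf : f.Injective) :
    MeasurePreserving (fun (X : ι → ℝ) k => X (f k)) (stdNormalPi ι) (stdNormalPi κ) := by
  have hind : iIndepFun (fun (i : ι) (X : ι → ℝ) => X i) (stdNormalPi ι) :=
    iIndepFun_pi (X := fun _ x => x) fun _ => aemeasurable_id
  have hlaw : ∀ i : ι, HasLaw (fun X : ι → ℝ => X i) (gaussianReal 0 1) (stdNormalPi ι) :=
    fun i => (measurePreserving_eval (fun _ : ι => gaussianReal 0 1) i).hasLaw
  exact ((hind.precomp hf).hasLaw_pi fun k => hlaw (f k)).measurePreserving (by fun_prop)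

/-- Disjoint sets of entries are independent; this separates `A_k` from the other columns. -/
theorem measurePreserving_prod_of_injective {κ' : Type*} [Fintype κ'] {f : κ → ι} {g : κ' → ι}
    (hfg : (Sum.elim f g).Injective) :
    MeasurePreserving (fun X : ι → ℝ => ((fun k => X (f k)), fun k => X (g k))) (stdNormalPi ι)
      ((stdNormalPi κ).prod (stdNormalPi κ')) :=
  (measurePreserving_sumPiEquivProdPi (fun _ : κ ⊕ κ' => gaussianReal 0 1)).comp
    (measurePreserving_comp_injective hfg)

theorem measurePreserving_columns :
    MeasurePreserving (fun (r : m → EuclideanSpace ℝ n) (j : n) => WithLp.toLp 2 fun i => r i j)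
      (gaussianRows m n) (gaussianRows n m) :=
  measurePreserving_rows.comp
    ((measurePreserving_comp_injective Prod.swap_injective).comp measurePreserving_entries)

end Laws

/-! ### Pseudoinverse of a Gaussian matrix -/

section GaussianPinv

variable {m n : ℕ}

theorem ae_isUnit_det (hmn : m ≤ n) :
    ∀ᵐ r ∂gaussianRows (Fin m) (Fin n), IsUnit (rowMatrix r * (rowMatrix r)ᵀ).det := by
  filter_upwards [ae_linearIndependent (E := EuclideanSpace ℝ (Fin n)) (q := m) (by simpa)]
    with r hr
  rw [← gram_eq_rowMatrix_mul_transpose]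
  exact (det_gram_ne_zero_iff_linearIndependent.mpr hr).isUnit

/-- `pinv` is defined by choice, so measurability comes from the explicit formula `Aᵀ (A Aᵀ)⁻¹`,
valid almost everywhere. -/
theorem aemeasurable_pinv_of_le (hmn : m ≤ n) (j : Fin n) (i : Fin m) :
    AEMeasurable (fun r => pinv (rowMatrix r) j i) (gaussianRows (Fin m) (Fin n)) := by
  refine AEMeasurable.congr
    (f := fun r : Fin m → EuclideanSpace ℝ (Fin n) => ∑ l, r l j * (gram ℝ r)⁻¹ l i) ?_ ?_
  · refine (Finset.measurable_fun_sum _ fun l _ => ?_).aemeasurable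
    exact (by fun_prop : Measurable fun r : Fin m → EuclideanSpace ℝ (Fin n) => r l j).mul
      (measurable_gram_inv_apply l i)
  · filter_upwards [ae_isUnit_det hmn] with r hr
    rw [pinv_eq_of_isUnit_det hr, mul_apply, gram_eq_rowMatrix_mul_transpose]
    rfl

theorem aemeasurable_pinv (j : Fin n) (i : Fin m) :
    AEMeasurable (fun r => pinv (rowMatrix r) j i) (gaussianRows (Fin m) (Fin n)) := by
  rcases le_total m n with h | h
  · exact aemeasurable_pinv_of_le h j i
  · have := AEMeasurable.comp_quasiMeasurePreserving (aemeasurable_pinv_of_le h i j)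
      (measurePreserving_columns (m := Fin m) (n := Fin n)).quasiMeasurePreserving
    refine this.congr (ae_of_all _ fun r => ?_)
    change pinv (rowMatrix r)ᵀ i j = _
    rw [pinv_transpose, transpose_apply]

theorem gamma_comm (m n : ℕ) : gamma m n = gamma n m := by
  unfold gamma
  rw [min_comm, max_comm]
  congr 1
  simp only [eq_iff_iff]
  omega

theorem lintegral_pinv_sq_of_le (hm : 0 < m) (hmn : m ≤ n) :
    ((∫⁻ r, ENNReal.ofReal (∑ j, ∑ i, pinv (rowMatrix r) j i ^ 2)
      ∂gaussianRows (Fin m) (Fin n) : ℝ≥0∞) : EReal) = gamma m n := by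
  have h := lintegral_trace_gram_inv (E := EuclideanSpace ℝ (Fin n)) (q := m) (by simpa) hm
  rw [finrank_euclideanSpace_fin] at h
  have hcongr : ∫⁻ r, ENNReal.ofReal (∑ j, ∑ i, pinv (rowMatrix r) j i ^ 2)
      ∂gaussianRows (Fin m) (Fin n) = ∫⁻ r, ENNReal.ofReal (gram ℝ r)⁻¹.trace
      ∂gaussianRows (Fin m) (Fin n) := by
    refine lintegral_congr_ae ?_
    filter_upwards [ae_isUnit_det hmn] with r hr
    rw [sum_sq_eq_trace, transpose_pinv_mul_pinv_of_isUnit_det hr,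
      gram_eq_rowMatrix_mul_transpose]
  rw [hcongr, h]
  unfold gamma
  rw [max_eq_left hmn, min_eq_right hmn]
  -- Given `m ≤ n`, this covers `n = m` and `n = m + 1`; the remaining infinite case of `gamma`
  -- arises only for `n < m`.
  by_cases hle : n ≤ m + 1
  · rw [if_pos hle, if_pos (by omega)]
    rfl
  · rw [if_neg hle, if_neg (by omega), EReal.coe_ennreal_ofReal, max_eq_left]
    have : (m : ℝ) + 1 < n := by exact_mod_cast not_le.mp hle
    exact div_nonneg (by positivity) (by linarith)

theorem aemeasurable_pinv_sq :
    AEMeasurable (fun r => ENNReal.ofReal (∑ j, ∑ i, pinv (rowMatrix r) j i ^ 2))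
      (gaussianRows (Fin m) (Fin n)) :=
  (Finset.aemeasurable_fun_sum _ fun j _ => Finset.aemeasurable_fun_sum _ fun i _ =>
    (aemeasurable_pinv j i).pow_const 2).ennreal_ofReal

/-- The expected squared Frobenius norm of the pseudoinverse of a Gaussian matrix. -/
theorem lintegral_pinv_sq (hm : 0 < m) (hn : 0 < n) :
    ((∫⁻ r, ENNReal.ofReal (∑ j, ∑ i, pinv (rowMatrix r) j i ^ 2)
      ∂gaussianRows (Fin m) (Fin n) : ℝ≥0∞) : EReal) = gamma m n := by
  rcases le_total m n with h | h
  · exact lintegral_pinv_sq_of_le hm h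
  · rw [gamma_comm, ← lintegral_pinv_sq_of_le hn h,
      ← (measurePreserving_columns (m := Fin m) (n := Fin n)).hasLaw.lintegral_comp
        aemeasurable_pinv_sq]
    congr 2
    funext r
    change _ = ENNReal.ofReal (∑ j, ∑ i, pinv (rowMatrix r)ᵀ j i ^ 2)
    rw [pinv_transpose, Finset.sum_comm]
    rfl

/-- Almost surely the rank is full, so `A A⁺ = 1` or `A⁺ A = 1` according to the shape. -/
theorem ae_trace_pinv_mul :
    ∀ᵐ r ∂gaussianRows (Fin m) (Fin n),
      (pinv (rowMatrix r) * rowMatrix r).trace = ((min n m : ℕ) : ℝ) := by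
  rcases le_total m n with h | h
  · filter_upwards [ae_isUnit_det h] with r hr
    rw [trace_mul_comm, mul_pinv_of_isUnit_det hr, trace_one, Fintype.card_fin, min_eq_right h]
  · filter_upwards [measurePreserving_columns.quasiMeasurePreserving.ae
      (ae_isUnit_det h)] with r hr
    change IsUnit ((rowMatrix r)ᵀ * (rowMatrix r)ᵀᵀ).det at hr
    have h1 := mul_pinv_of_isUnit_det hr
    rw [pinv_transpose, ← transpose_mul, ← transpose_one, transpose_inj] at h1
    rw [h1, trace_one, Fintype.card_fin, min_eq_left h]

end GaussianPinv

/-! ### The row space projection and its behaviour under isometries -/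

section Projection

theorem mulVec_dotProduct_mulVec_of_projection {n : Type*} [Fintype n] {Q : Matrix n n ℝ}
    (hQ : Qᵀ = Q) (hQQ : Q * Q = Q) (x : n → ℝ) : (Q *ᵥ x) ⬝ᵥ (Q *ᵥ x) = x ⬝ᵥ (Q *ᵥ x) := by
  rw [dotProduct_mulVec, ← mulVec_transpose, mulVec_mulVec, hQ, hQQ, dotProduct_comm]

variable {m n : Type*} [Fintype m] [Fintype n]

theorem pinv_mul_dotProduct (A : Matrix m n ℝ) (x : n → ℝ) :
    ((pinv A * A) *ᵥ x) ⬝ᵥ ((pinv A * A) *ᵥ x) = x ⬝ᵥ ((pinv A * A) *ᵥ x) :=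
  mulVec_dotProduct_mulVec_of_projection (pinv_spec A).right_symm
    (by rw [← Matrix.mul_assoc, (pinv_spec A).mul_mul_inv]) x

theorem pinv_mul_quadratic_nonneg (A : Matrix m n ℝ) (x : n → ℝ) :
    0 ≤ x ⬝ᵥ ((pinv A * A) *ᵥ x) := by
  rw [← pinv_mul_dotProduct]
  exact Finset.sum_nonneg fun i _ => mul_self_nonneg _

theorem pinv_mul_quadratic_le (A : Matrix m n ℝ) (x : n → ℝ) :
    x ⬝ᵥ ((pinv A * A) *ᵥ x) ≤ x ⬝ᵥ x := by
  have h : 0 ≤ (x - (pinv A * A) *ᵥ x) ⬝ᵥ (x - (pinv A * A) *ᵥ x) :=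
    Finset.sum_nonneg fun i _ => mul_self_nonneg _
  rw [sub_dotProduct, dotProduct_sub, dotProduct_sub, pinv_mul_dotProduct,
    dotProduct_comm ((pinv A * A) *ᵥ x) x] at h
  linarith

theorem rowMatrix_comp_isometry {m n : Type*} [Fintype n] [DecidableEq n]
    (O : EuclideanSpace ℝ n ≃ₗᵢ[ℝ] EuclideanSpace ℝ n) :
    ∃ Q : Matrix n n ℝ, Q * Qᵀ = 1 ∧ (∀ r : m → EuclideanSpace ℝ n,
      rowMatrix (fun i => O (r i)) = rowMatrix r * Q) ∧
      ∀ x : EuclideanSpace ℝ n, Q *ᵥ x.ofLp = (O.symm x).ofLp := by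
  have he : ∀ (v : EuclideanSpace ℝ n) (l : n), inner ℝ (EuclideanSpace.single l (1 : ℝ)) v = v l :=
    fun v l => by simp [EuclideanSpace.inner_single_left]
  -- Row `l` of `Q` is the image of the `l`-th basis vector, so right multiplication by `Q` applies
  -- `O` to rows, while `Q *ᵥ` applies the inverse.
  refine ⟨Matrix.of fun l j => O (EuclideanSpace.single l 1) j, ?_, fun r => ?_, fun x => ?_⟩
  · ext l l'
    have h : inner ℝ (O (EuclideanSpace.single l' (1 : ℝ))) (O (EuclideanSpace.single l (1 : ℝ)))
        = (1 : Matrix n n ℝ) l l' := by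
      rw [O.inner_map_map, he]
      simp [one_apply, eq_comm]
    rw [← h, mul_apply, PiLp.inner_apply]
    rfl
  · ext i j
    have h : r i = ∑ l, r i l • EuclideanSpace.single l (1 : ℝ) := by
      ext l
      simp [Pi.single_apply]
    change (O (r i)) j = _
    conv_lhs => rw [h, map_sum]
    simp [mul_apply, rowMatrix]
  · ext l
    rw [← he, ← O.inner_map_map, O.apply_symm_apply]
    simp [mulVec, dotProduct, PiLp.inner_apply, mul_comm]

end Projection

/-! ### Mean of the row space projection -/

section ExpectedProjection

variable {m n : ℕ}

theorem integrable_pinv_mul_quadratic (x : Fin n → ℝ) :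
    Integrable (fun r => x ⬝ᵥ ((pinv (rowMatrix r) * rowMatrix r) *ᵥ x))
      (gaussianRows (Fin m) (Fin n)) := by
  refine Integrable.of_bound ?_ (x ⬝ᵥ x) (ae_of_all _ fun r => ?_)
  · refine AEMeasurable.aestronglyMeasurable ?_
    simp only [dotProduct, mulVec, mul_apply]
    refine Finset.aemeasurable_fun_sum _ fun j _ => (Finset.aemeasurable_fun_sum _ fun l _ =>
      (Finset.aemeasurable_fun_sum _ fun i _ => (aemeasurable_pinv j i).mul ?_).mul_const _).const_mul _
    exact (by fun_prop : Measurable fun r : Fin m → EuclideanSpace ℝ (Fin n) =>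
      r i l).aemeasurable
  · rw [Real.norm_of_nonneg (pinv_mul_quadratic_nonneg _ _)]
    exact pinv_mul_quadratic_le _ _

theorem integral_pinv_mul_quadratic_isometry
    (O : EuclideanSpace ℝ (Fin n) ≃ₗᵢ[ℝ] EuclideanSpace ℝ (Fin n)) (x : EuclideanSpace ℝ (Fin n)) :
    ∫ r, (O.symm x).ofLp ⬝ᵥ ((pinv (rowMatrix r) * rowMatrix r) *ᵥ (O.symm x).ofLp)
        ∂gaussianRows (Fin m) (Fin n)
      = ∫ r, x.ofLp ⬝ᵥ ((pinv (rowMatrix r) * rowMatrix r) *ᵥ x.ofLp)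
        ∂gaussianRows (Fin m) (Fin n) := by
  obtain ⟨Q, hQ, hr, hx⟩ := rowMatrix_comp_isometry (m := Fin m) O
  have hO : MeasurePreserving (fun (r : Fin m → EuclideanSpace ℝ (Fin n)) i => O (r i))
      (gaussianRows (Fin m) (Fin n)) (gaussianRows (Fin m) (Fin n)) :=
    measurePreserving_pi _ _ fun _ => ⟨by fun_prop, stdGaussian_map O⟩
  rw [← hO.hasLaw.integral_comp (integrable_pinv_mul_quadratic x.ofLp).aestronglyMeasurable]
  congr 1
  funext r
  rw [Function.comp_apply, hr, pinv_mul_orthogonal _ hQ, ← hx]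
  simp only [← mulVec_mulVec]
  rw [dotProduct_mulVec x.ofLp, vecMul_transpose]

/-- A Gaussian row space is isotropic. -/
theorem integral_pinv_mul_quadratic (x : EuclideanSpace ℝ (Fin n)) :
    ∫ r, x.ofLp ⬝ᵥ ((pinv (rowMatrix r) * rowMatrix r) *ᵥ x.ofLp)
        ∂gaussianRows (Fin m) (Fin n) = ‖x‖ ^ 2 * (((min n m : ℕ) : ℝ) / n) := by
  rcases Nat.eq_zero_or_pos n with rfl | hn
  · simp [Subsingleton.elim x 0]
  have hsingle : ∀ j : Fin n, ∫ r, x.ofLp ⬝ᵥ ((pinv (rowMatrix r) * rowMatrix r) *ᵥ x.ofLp)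
        ∂gaussianRows (Fin m) (Fin n)
      = ‖x‖ ^ 2 * ∫ r, (pinv (rowMatrix r) * rowMatrix r) j j ∂gaussianRows (Fin m) (Fin n) := by
    intro j
    have hnorm : ‖x‖ = ‖EuclideanSpace.single j ‖x‖‖ := by simp
    -- The reflection along `x - ‖x‖ e_j` carries `x` to `‖x‖ e_j`. Hence every diagonal entry
    -- yields the same value, and summing over `j` produces the trace.
    have h := integral_pinv_mul_quadratic_isometry (m := m)
      ((Submodule.span ℝ {x - EuclideanSpace.single j ‖x‖})ᗮ.reflection) x
    rw [Submodule.reflection_symm, Submodule.reflection_sub hnorm] at h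
    rw [← h, ← integral_const_mul]
    congr 1
    funext r
    simp [mulVec_single, sq, mul_comm, mul_left_comm]
  have hint : ∀ j : Fin n, Integrable (fun r => (pinv (rowMatrix r) * rowMatrix r) j j)
      (gaussianRows (Fin m) (Fin n)) := fun j => by
    simpa using integrable_pinv_mul_quadratic (m := m) (Pi.single j (1 : ℝ))
  have hsum : (n : ℝ) * ∫ r, x.ofLp ⬝ᵥ ((pinv (rowMatrix r) * rowMatrix r) *ᵥ x.ofLp)
        ∂gaussianRows (Fin m) (Fin n) = ‖x‖ ^ 2 * ((min n m : ℕ) : ℝ) := by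
    calc _ = ∑ j : Fin n, ‖x‖ ^ 2 * ∫ r, (pinv (rowMatrix r) * rowMatrix r) j j
          ∂gaussianRows (Fin m) (Fin n) := by
          rw [← Finset.sum_congr rfl fun j _ => hsingle j]
          simp
      _ = ‖x‖ ^ 2 * ∫ r, (pinv (rowMatrix r) * rowMatrix r).trace
          ∂gaussianRows (Fin m) (Fin n) := by
          rw [← Finset.mul_sum, ← integral_finsetSum _ fun j _ => hint j]
          rfl
      _ = _ := by
          rw [integral_congr_ae ae_trace_pinv_mul]
          simp
  have hn' : (n : ℝ) ≠ 0 := by positivity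
  field_simp
  linarith

end ExpectedProjection

end CoCoA

end

noncomputable section

namespace CoCoA

/-! ### Second moments of affine forms in Gaussian variables -/

section SecondMoment

variable {ι : Type*} [Fintype ι]

theorem memLp_linear_stdNormalPi (w : ι → ℝ) :
    MemLp (fun Z => ∑ i, w i * Z i) 2 (stdNormalPi ι) :=
  memLp_finsetSum _ fun i _ => MemLp.const_mul
    ((IsGaussian.memLp_two_id (μ := gaussianReal 0 1)).comp_measurePreserving
      (measurePreserving_eval (fun _ : ι => gaussianReal 0 1) i)) (w i)

theorem integral_linear_stdNormalPi (w : ι → ℝ) :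
    ∫ Z, ∑ i, w i * Z i ∂stdNormalPi ι = 0 := by
  rw [integral_finsetSum]
  · refine Finset.sum_eq_zero fun i _ => ?_
    rw [integral_const_mul, integral_eval, integral_id_gaussianReal, mul_zero]
  · exact fun i _ => (integrable_eval IsGaussian.integrable_id).const_mul _

theorem integral_linear_sq_stdNormalPi (w : ι → ℝ) :
    ∫ Z, (∑ i, w i * Z i) ^ 2 ∂stdNormalPi ι = ∑ i, w i ^ 2 := by
  have h := variance_eq_sub (memLp_linear_stdNormalPi w)
  rw [integral_linear_stdNormalPi, zero_pow two_ne_zero, sub_zero] at h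
  have hv : Var[fun Z => ∑ i, w i * Z i; stdNormalPi ι] = ∑ i, w i ^ 2 := by
    have h1 : (fun Z : ι → ℝ => ∑ i, w i * Z i) = ∑ i, fun Z : ι → ℝ => w i * Z i := by
      ext Z
      simp
    rw [h1, variance_sum_pi (X := fun i z => w i * z)]
    · refine Finset.sum_congr rfl fun i _ => ?_
      change Var[fun z => w i * id z; gaussianReal 0 1] = _
      rw [variance_const_mul, variance_id_gaussianReal]
      simp
    · exact fun i => IsGaussian.memLp_two_id.const_mul _
  rw [← hv, h]
  rfl

theorem integrable_affine_sq_stdNormalPi (c : ℝ) (w : ι → ℝ) :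
    Integrable (fun Z => (c - ∑ i, w i * Z i) ^ 2) (stdNormalPi ι) :=
  ((memLp_const c).sub (memLp_linear_stdNormalPi w)).integrable_sq

theorem integral_affine_sq_stdNormalPi (c : ℝ) (w : ι → ℝ) :
    ∫ Z, (c - ∑ i, w i * Z i) ^ 2 ∂stdNormalPi ι = c ^ 2 + ∑ i, w i ^ 2 := by
  have hS := memLp_linear_stdNormalPi w
  have h1 : ∀ Z : ι → ℝ, (c - ∑ i, w i * Z i) ^ 2
      = (c ^ 2 - 2 * c * ∑ i, w i * Z i) + (∑ i, w i * Z i) ^ 2 := fun Z => by ring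
  have hi : Integrable (fun Z => 2 * c * ∑ i, w i * Z i) (stdNormalPi ι) :=
    (hS.integrable one_le_two).const_mul _
  have hci : Integrable (fun Z => c ^ 2 - 2 * c * ∑ i, w i * Z i) (stdNormalPi ι) :=
    (integrable_const _).sub hi
  simp_rw [h1]
  rw [integral_add hci hS.integrable_sq,
    integral_sub (integrable_const _) hi, integral_const_mul, integral_linear_stdNormalPi,
    integral_linear_sq_stdNormalPi]
  simp

/-- Coordinate `j` of `T Z x` is linear in the entries of `Z` with coefficients `T j i * x l`, so
its variance factors. -/
theorem lintegral_sum_affine_sq {m q κ : Type*} [Fintype m] [Fintype q] [Fintype κ]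
    (c : q → ℝ) (T : Matrix q m ℝ) (x : κ → ℝ) :
    ∫⁻ Z, ENNReal.ofReal (∑ j, (c j - (T *ᵥ (Matrix.of (fun i l => Z (i, l)) *ᵥ x)) j) ^ 2)
        ∂stdNormalPi (m × κ)
      = ENNReal.ofReal (∑ j, c j ^ 2 + (∑ l, x l ^ 2) * ∑ j, ∑ i, T j i ^ 2) := by
  have h : ∀ (Z : m × κ → ℝ) (j : q), (T *ᵥ (Matrix.of (fun i l => Z (i, l)) *ᵥ x)) j
      = ∑ il : m × κ, (T j il.1 * x il.2) * Z il := by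
    intro Z j
    simp only [mulVec, dotProduct, Matrix.of_apply, Finset.mul_sum, Fintype.sum_prod_type]
    exact Finset.sum_congr rfl fun i _ => Finset.sum_congr rfl fun l _ => by ring
  simp_rw [h]
  rw [← ofReal_integral_eq_lintegral_ofReal
    (integrable_finsetSum _ fun j _ => integrable_affine_sq_stdNormalPi _ _)
    (ae_of_all _ fun Z => Finset.sum_nonneg fun j _ => sq_nonneg _),
    integral_finsetSum _ fun j _ => integrable_affine_sq_stdNormalPi _ _]
  simp_rw [integral_affine_sq_stdNormalPi]
  rw [Finset.sum_add_distrib]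
  congr 2
  simp only [Fintype.sum_prod_type, mul_pow, ← Finset.mul_sum, ← Finset.sum_mul]
  ring

end SecondMoment

/-! ### Expected error of one node -/

section BlockError

variable {n q : ℕ} {κ : Type*} [Fintype κ]

/-- The squared error of a node with unknowns `x₁`, for the rows `r` of its column block and the
entries `Z` of the other columns, whose unknowns are `x₂`. -/
def blockError (c : ℝ) (x₁ : EuclideanSpace ℝ (Fin q)) (x₂ : κ → ℝ)
    (r : Fin n → EuclideanSpace ℝ (Fin q)) (Z : Fin n × κ → ℝ) : ℝ≥0∞ :=
  ENNReal.ofReal (∑ j, (x₁ j - c * (pinv (rowMatrix r) *ᵥ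
    (rowMatrix r *ᵥ x₁.ofLp + Matrix.of (fun i l => Z (i, l)) *ᵥ x₂)) j) ^ 2)

variable (c : ℝ) (x₁ : EuclideanSpace ℝ (Fin q)) (x₂ : κ → ℝ)

theorem aemeasurable_blockError :
    AEMeasurable (fun rZ => blockError c x₁ x₂ rZ.1 rZ.2)
      ((gaussianRows (Fin n) (Fin q)).prod (stdNormalPi (Fin n × κ))) := by
  refine AEMeasurable.ennreal_ofReal ?_
  refine Finset.aemeasurable_fun_sum _ fun j _ => AEMeasurable.pow_const ?_ 2
  refine (AEMeasurable.const_mul ?_ c).const_sub (x₁ j)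
  simp only [mulVec, dotProduct]
  refine Finset.aemeasurable_fun_sum _ fun i _ => AEMeasurable.mul ?_ ?_
  · exact AEMeasurable.comp_quasiMeasurePreserving (aemeasurable_pinv j i)
      Measure.quasiMeasurePreserving_fst
  · simp only [Pi.add_apply, mulVec, dotProduct, rowMatrix, Matrix.of_apply]
    exact Measurable.aemeasurable (by fun_prop)

theorem sum_sq_sub_smul_pinv_mul (A : Matrix (Fin n) (Fin q) ℝ) :
    ∑ j, (x₁ j - c * ((pinv A * A) *ᵥ x₁.ofLp) j) ^ 2
      = ‖x₁‖ ^ 2 + (c ^ 2 - 2 * c) * (x₁.ofLp ⬝ᵥ ((pinv A * A) *ᵥ x₁.ofLp)) := by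
  have h := pinv_mul_dotProduct A x₁.ofLp
  set y := (pinv A * A) *ᵥ x₁.ofLp
  calc ∑ j, (x₁ j - c * y j) ^ 2
      = ∑ j, x₁ j ^ 2 - 2 * c * (x₁.ofLp ⬝ᵥ y) + c ^ 2 * (y ⬝ᵥ y) := by
        simp only [dotProduct, Finset.mul_sum]
        rw [← Finset.sum_sub_distrib, ← Finset.sum_add_distrib]
        exact Finset.sum_congr rfl fun j _ => by ring
    _ = _ := by
        rw [h, EuclideanSpace.real_norm_sq_eq]
        ring

theorem lintegral_blockError :
    ∫⁻ rZ, blockError c x₁ x₂ rZ.1 rZ.2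
        ∂(gaussianRows (Fin n) (Fin q)).prod (stdNormalPi (Fin n × κ))
      = ENNReal.ofReal (‖x₁‖ ^ 2 * (1 + (c ^ 2 - 2 * c) * (((min q n : ℕ) : ℝ) / q)))
        + ENNReal.ofReal (c ^ 2 * ∑ l, x₂ l ^ 2) *
          ∫⁻ r, ENNReal.ofReal (∑ j, ∑ i, pinv (rowMatrix r) j i ^ 2)
            ∂gaussianRows (Fin n) (Fin q) := by
  have hin : ∀ r : Fin n → EuclideanSpace ℝ (Fin q),
      ∫⁻ Z, blockError c x₁ x₂ r Z ∂stdNormalPi (Fin n × κ)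
        = ENNReal.ofReal (‖x₁‖ ^ 2 + (c ^ 2 - 2 * c) *
            (x₁.ofLp ⬝ᵥ ((pinv (rowMatrix r) * rowMatrix r) *ᵥ x₁.ofLp)))
          + ENNReal.ofReal (c ^ 2 * ∑ l, x₂ l ^ 2) *
            ENNReal.ofReal (∑ j, ∑ i, pinv (rowMatrix r) j i ^ 2) := by
    intro r
    have h := lintegral_sum_affine_sq
      (fun j => x₁ j - c * ((pinv (rowMatrix r) * rowMatrix r) *ᵥ x₁.ofLp) j)
      (c • pinv (rowMatrix r)) x₂
    have hl : ∀ Z : Fin n × κ → ℝ, blockError c x₁ x₂ r Z = ENNReal.ofReal (∑ j,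
        (x₁ j - c * ((pinv (rowMatrix r) * rowMatrix r) *ᵥ x₁.ofLp) j
          - ((c • pinv (rowMatrix r)) *ᵥ (Matrix.of (fun i l => Z (i, l)) *ᵥ x₂)) j) ^ 2) := by
      intro Z
      rw [blockError]
      congr 1
      refine Finset.sum_congr rfl fun j _ => ?_
      rw [mulVec_add, mulVec_mulVec, smul_mulVec, Pi.add_apply, Pi.smul_apply, smul_eq_mul]
      ring
    simp_rw [hl, h]
    rw [ENNReal.ofReal_add (Finset.sum_nonneg fun j _ => sq_nonneg _) (by positivity),
      sum_sq_sub_smul_pinv_mul, ← ENNReal.ofReal_mul (by positivity)]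
    congr 2
    simp only [Matrix.smul_apply, smul_eq_mul, mul_pow, ← Finset.mul_sum]
    ring
  rw [lintegral_prod _ (aemeasurable_blockError c x₁ x₂)]
  simp_rw [hin]
  have hint := (integrable_pinv_mul_quadratic (m := n) x₁.ofLp).const_mul (c ^ 2 - 2 * c)
  have hcint : Integrable (fun r => ‖x₁‖ ^ 2 + (c ^ 2 - 2 * c) *
      (x₁.ofLp ⬝ᵥ ((pinv (rowMatrix r) * rowMatrix r) *ᵥ x₁.ofLp)))
      (gaussianRows (Fin n) (Fin q)) := (integrable_const _).add hint
  rw [lintegral_add_left' hcint.aemeasurable.ennreal_ofReal,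
    lintegral_const_mul'' _ aemeasurable_pinv_sq,
    ← ofReal_integral_eq_lintegral_ofReal hcint]
  · congr 2
    rw [integral_add (integrable_const _) hint, integral_const_mul, integral_pinv_mul_quadratic]
    simp
    ring
  -- The coefficient `c ^ 2 - 2 * c` may be negative; nonnegativity comes from the expression being
  -- a sum of squares.
  · refine ae_of_all _ fun r => ?_
    change 0 ≤ ‖x₁‖ ^ 2 + (c ^ 2 - 2 * c) *
      (x₁.ofLp ⬝ᵥ ((pinv (rowMatrix r) * rowMatrix r) *ᵥ x₁.ofLp))
    rw [← sum_sq_sub_smul_pinv_mul]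
    exact Finset.sum_nonneg fun j _ => sq_nonneg _

end BlockError

/-! ### Splitting the matrix into one column block and the rest -/

section Blocks

variable {n K : ℕ} {p : Fin K → ℕ} (k : Fin K)

theorem sumElim_block_bijective :
    (Sum.elim (fun j : Fin (p k) => (⟨k, j⟩ : Idx p))
      (Subtype.val : {j : Idx p // j.1 ≠ k} → Idx p)).Bijective := by
  constructor
  · rintro (j | ⟨j, hj⟩) (l | ⟨l, hl⟩) h
    · simpa using h
    · exact absurd (congrArg Sigma.fst h).symm hl
    · exact absurd (congrArg Sigma.fst h) hj
    · simpa using h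
  · rintro ⟨i, j⟩
    by_cases h : i = k
    · subst h
      exact ⟨Sum.inl j, rfl⟩
    · exact ⟨Sum.inr ⟨⟨i, j⟩, h⟩, rfl⟩

theorem sum_eq_block_add_rest {M : Type*} [AddCommMonoid M] (f : Idx p → M) :
    ∑ j, f j = ∑ j : Fin (p k), f ⟨k, j⟩ + ∑ j : {j : Idx p // j.1 ≠ k}, f j := by
  rw [← (Equiv.ofBijective _ (sumElim_block_bijective k)).sum_comp, Fintype.sum_sum_type]
  rfl

/-- The rows of the column block of node `k`. -/
def blockRows (X : Fin n × Idx p → ℝ) (i : Fin n) : EuclideanSpace ℝ (Fin (p k)) :=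
  WithLp.toLp 2 fun j => X (i, ⟨k, j⟩)

/-- The entries outside the column block of node `k`. -/
def restEntries (X : Fin n × Idx p → ℝ) (il : Fin n × {j : Idx p // j.1 ≠ k}) : ℝ :=
  X (il.1, il.2)

theorem measurePreserving_block_rest :
    MeasurePreserving (fun X : Fin n × Idx p → ℝ => (blockRows k X, restEntries k X))
      (stdNormalPi (Fin n × Idx p)) ((gaussianRows (Fin n) (Fin (p k))).prod
        (stdNormalPi (Fin n × {j : Idx p // j.1 ≠ k}))) := by
  have hinj : (Sum.elim (fun ij : Fin n × Fin (p k) => ((ij.1, ⟨k, ij.2⟩) : Fin n × Idx p))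
      (fun il : Fin n × {j : Idx p // j.1 ≠ k} => (il.1, il.2.1))).Injective := by
    have hi := (sumElim_block_bijective (p := p) k).injective
    rintro (⟨i, j⟩ | ⟨i, j⟩) (⟨l, j'⟩ | ⟨l, j'⟩) h <;> obtain ⟨h1, h2⟩ := Prod.mk.inj h
    · have := hi (a₁ := Sum.inl j) (a₂ := Sum.inl j') h2
      simp_all
    · exact absurd (hi (a₁ := Sum.inl j) (a₂ := Sum.inr j') h2) (by simp)
    · exact absurd (hi (a₁ := Sum.inr j) (a₂ := Sum.inl j') h2) (by simp)
    · have := hi (a₁ := Sum.inr j) (a₂ := Sum.inr j') h2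
      simp_all
  exact (measurePreserving_rows.prod (MeasurePreserving.id _)).comp
    (measurePreserving_prod_of_injective hinj)

theorem colBlock_eq_rowMatrix (X : Fin n × Idx p → ℝ) :
    colBlock (Matrix.of fun i j => X (i, j)) k = rowMatrix (blockRows k X) := rfl

theorem mulVec_eq_block_add_rest (X : Fin n × Idx p → ℝ) (x : EuclideanSpace ℝ (Idx p)) :
    Matrix.of (fun i j => X (i, j)) *ᵥ x.ofLp
      = rowMatrix (blockRows k X) *ᵥ (vecBlock x k).ofLp
        + Matrix.of (fun i l => restEntries k X (i, l)) *ᵥ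
          fun l : {j : Idx p // j.1 ≠ k} => x l := by
  ext i
  simp only [mulVec, dotProduct, Pi.add_apply, Matrix.of_apply]
  exact sum_eq_block_add_rest k _

theorem ofReal_norm_sub_estimate_sq (X : Fin n × Idx p → ℝ) (x : EuclideanSpace ℝ (Idx p)) :
    ENNReal.ofReal (‖x - estimate 0 (Matrix.of fun i j => X (i, j))
        (Matrix.of (fun i j => X (i, j)) *ᵥ x.ofLp) 1‖ ^ 2)
      = ∑ k, blockError (K : ℝ)⁻¹ (vecBlock x k) (fun l : {j : Idx p // j.1 ≠ k} => x l)
          (blockRows k X) (restEntries k X) := by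
  rw [EuclideanSpace.real_norm_sq_eq, Fintype.sum_sigma,
    ENNReal.ofReal_sum_of_nonneg fun k _ => Finset.sum_nonneg fun j _ => sq_nonneg _]
  refine Finset.sum_congr rfl fun k _ => ?_
  rw [blockError, ← mulVec_eq_block_add_rest]
  congr 1
  refine Finset.sum_congr rfl fun j _ => ?_
  rw [PiLp.sub_apply, estimate_one_apply, colBlock_eq_rowMatrix]
  rfl

theorem aemeasurable_estimate (x : EuclideanSpace ℝ (Idx p)) :
    AEMeasurable (fun X : Fin n × Idx p → ℝ => estimate 0 (Matrix.of fun i j => X (i, j))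
      (Matrix.of (fun i j => X (i, j)) *ᵥ x.ofLp) 1) (stdNormalPi (Fin n × Idx p)) := by
  have h : AEMeasurable (fun (X : Fin n × Idx p → ℝ) (j : Idx p) =>
      estimate 0 (Matrix.of fun i j => X (i, j)) (Matrix.of (fun i j => X (i, j)) *ᵥ x.ofLp) 1 j)
      (stdNormalPi (Fin n × Idx p)) := by
    refine aemeasurable_pi_iff.mpr fun j => ?_
    simp_rw [estimate_one_apply, colBlock_eq_rowMatrix]
    simp only [mulVec, dotProduct]
    refine AEMeasurable.const_mul (Finset.aemeasurable_fun_sum _ fun i _ => ?_) (K : ℝ)⁻¹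
    refine AEMeasurable.mul ?_ ?_
    · exact AEMeasurable.comp_quasiMeasurePreserving (AEMeasurable.comp_quasiMeasurePreserving
        (aemeasurable_pinv j.2 i) Measure.quasiMeasurePreserving_fst)
        (measurePreserving_block_rest j.1).quasiMeasurePreserving
    · simp only [Matrix.of_apply]
      exact Measurable.aemeasurable (by fun_prop)
  exact (WithLp.measurable_toLp 2 _).comp_aemeasurable h

end Blocks

/-! ### Assembling the constants -/

section Constants

theorem coe_ennreal_sum {ι : Type*} (s : Finset ι) (f : ι → ℝ≥0∞) :
    ((∑ i ∈ s, f i : ℝ≥0∞) : EReal) = ∑ i ∈ s, (f i : EReal) :=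
  map_sum (⟨⟨(↑), EReal.coe_ennreal_zero⟩, EReal.coe_ennreal_add⟩ : ℝ≥0∞ →+ EReal) f s

theorem coe_ofReal_of_nonneg {a : ℝ} (ha : 0 ≤ a) : ((ENNReal.ofReal a : ℝ≥0∞) : EReal) = a := by
  rw [EReal.coe_ennreal_ofReal, max_eq_left ha]

theorem sum_rest_sq {K : ℕ} {p : Fin K → ℕ} (x : EuclideanSpace ℝ (Idx p)) (k : Fin K) :
    ∑ l : {j : Idx p // j.1 ≠ k}, x l ^ 2 = ∑ i ∈ Finset.univ.erase k, ‖vecBlock x i‖ ^ 2 := by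
  have h := sum_eq_block_add_rest k fun j => x j ^ 2
  rw [Fintype.sum_sigma, ← Finset.add_sum_erase _ _ (Finset.mem_univ k)] at h
  simp_rw [EuclideanSpace.real_norm_sq_eq]
  exact (add_left_cancel h).symm

theorem sum_erase_mul_comm {ι R : Type*} [Fintype ι] [DecidableEq ι] [CommSemiring R]
    (f g : ι → R) :
    ∑ k, (∑ i ∈ Finset.univ.erase k, f i) * g k = ∑ k, f k * ∑ i ∈ Finset.univ.erase k, g i := by
  simp_rw [Finset.sum_mul, Finset.mul_sum]
  exact Finset.sum_comm' (by simp [eq_comm])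

/-- Sum of the expected errors of the nodes. -/
theorem sum_error_eq {n K : ℕ} {p : Fin K → ℕ} (x : EuclideanSpace ℝ (Idx p))
    {G : Fin K → ℝ≥0∞} (hG : ∀ k, (G k : EReal) = gamma n (p k)) :
    ((∑ k, (ENNReal.ofReal (‖vecBlock x k‖ ^ 2 *
          (1 + ((K : ℝ)⁻¹ ^ 2 - 2 * (K : ℝ)⁻¹) * (((min (p k) n : ℕ) : ℝ) / (p k : ℝ))))
        + ENNReal.ofReal ((K : ℝ)⁻¹ ^ 2 * ∑ l : {j : Idx p // j.1 ≠ k}, x l ^ 2) * G k) : ℝ≥0∞) :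
        EReal)
      = ∑ k, ((‖vecBlock x k‖ ^ 2 : ℝ) : EReal) * alpha n p k := by
  set N : Fin K → ℝ≥0∞ := fun k => ENNReal.ofReal (‖vecBlock x k‖ ^ 2) with hN
  set u : ℝ≥0∞ := ENNReal.ofReal (1 / (K : ℝ) ^ 2) with hu
  set b : Fin K → ℝ := fun k =>
    (K : ℝ) ^ 2 + (1 - 2 * (K : ℝ)) * (((min (p k) n : ℕ) : ℝ) / (p k : ℝ)) with hb
  -- The ratio is at most `1`, so `b k ≥ (K - 1) ^ 2`. Thus `alpha` is a coercion from `ℝ≥0∞`, where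
  -- sums distribute even with infinite terms and `0 * ⊤ = 0`.
  have hb0 : ∀ k, 0 ≤ b k := by
    intro k
    have hK : (1 : ℝ) ≤ K := by exact_mod_cast k.pos
    have h1 : ((min (p k) n : ℕ) : ℝ) / (p k : ℝ) ≤ 1 :=
      div_le_one_of_le₀ (by exact_mod_cast min_le_left _ _) (by positivity)
    have h2 := sq_nonneg ((K : ℝ) - 1)
    simp only [hb]
    nlinarith
  have halpha : ∀ k, alpha n p k
      = ((u * (ENNReal.ofReal (b k) + ∑ i ∈ Finset.univ.erase k, G i) : ℝ≥0∞) : EReal) := by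
    intro k
    rw [EReal.coe_ennreal_mul, EReal.coe_ennreal_add, coe_ennreal_sum, hu,
      coe_ofReal_of_nonneg (by positivity), coe_ofReal_of_nonneg (hb0 k)]
    simp_rw [hG]
    rfl
  have hterm : ∀ k, ENNReal.ofReal (‖vecBlock x k‖ ^ 2 *
          (1 + ((K : ℝ)⁻¹ ^ 2 - 2 * (K : ℝ)⁻¹) * (((min (p k) n : ℕ) : ℝ) / (p k : ℝ))))
        + ENNReal.ofReal ((K : ℝ)⁻¹ ^ 2 * ∑ l : {j : Idx p // j.1 ≠ k}, x l ^ 2) * G k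
      = N k * (u * ENNReal.ofReal (b k)) + u * ((∑ i ∈ Finset.univ.erase k, N i) * G k) := by
    intro k
    have hK : (K : ℝ) ≠ 0 := by
      have := k.pos
      positivity
    rw [hN, hu, ← ENNReal.ofReal_mul (by positivity), ← ENNReal.ofReal_mul (by positivity),
      sum_rest_sq, ← ENNReal.ofReal_sum_of_nonneg fun i _ => by positivity,
      ← mul_assoc (ENNReal.ofReal (1 / (K : ℝ) ^ 2)), ← ENNReal.ofReal_mul (by positivity),
      inv_pow, one_div]
    congr 3
    simp only [hb]
    field_simp
  simp_rw [hterm, halpha]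
  rw [Finset.sum_add_distrib, ← Finset.mul_sum, sum_erase_mul_comm, Finset.mul_sum,
    ← Finset.sum_add_distrib, coe_ennreal_sum]
  refine Finset.sum_congr rfl fun k _ => ?_
  rw [← coe_ofReal_of_nonneg (sq_nonneg ‖vecBlock x k‖), ← EReal.coe_ennreal_mul]
  congr 1
  change _ = N k * _
  ring

end Constants

end CoCoA

end

/-! ### The theorem, transferred from the canonical Gaussian space -/

theorem theorem1 {Ω : Type*} [MeasurableSpace Ω] (P : Measure Ω) [IsProbabilityMeasure P]
    {n K : ℕ} (hn : 0 < n) (p : Fin K → ℕ) (hp : ∀ k, 0 < p k)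
    (a : Fin n → Ω → EuclideanSpace ℝ (CoCoA.Idx p))
    (ha_law : ∀ i, HasLaw (a i) (stdGaussian (EuclideanSpace ℝ (CoCoA.Idx p))) P)
    (ha_indep : iIndepFun a P)
    (x : EuclideanSpace ℝ (CoCoA.Idx p))
    (A : Ω → Matrix (Fin n) (CoCoA.Idx p) ℝ)
    (hA : ∀ ω, A ω = CoCoA.regressorMatrix fun i => a i ω)
    (y : Ω → Fin n → ℝ) (hy : ∀ ω, y ω = CoCoA.observations (A ω) x 0) :
    AEMeasurable (fun ω => CoCoA.estimate 0 (A ω) (y ω) 1) P ∧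
      (CoCoA.generalizationError P x (fun ω => CoCoA.estimate 0 (A ω) (y ω) 1) : EReal)
        = ∑ k, ((‖CoCoA.vecBlock x k‖ ^ 2 : ℝ) : EReal) * CoCoA.alpha n p k := by
  set X : Ω → Fin n × CoCoA.Idx p → ℝ := fun ω ij => a ij.1 ω ij.2 with hX
  have hlaw : HasLaw X (CoCoA.stdNormalPi (Fin n × CoCoA.Idx p)) P :=
    CoCoA.measurePreserving_entries.fun_comp_hasLaw (ha_indep.hasLaw_pi ha_law)
  have hest : ∀ ω, CoCoA.estimate 0 (A ω) (y ω) 1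
      = CoCoA.estimate 0 (Matrix.of fun i j => X ω (i, j))
        (Matrix.of (fun i j => X ω (i, j)) *ᵥ x.ofLp) 1 := by
    intro ω
    rw [hy, CoCoA.observations, add_zero, hA]
    rfl
  simp_rw [hest]
  have hmeas_estimate := CoCoA.aemeasurable_estimate (n := n) x
  rw [← hlaw.map_eq] at hmeas_estimate
  refine ⟨hmeas_estimate.comp_aemeasurable hlaw.aemeasurable, ?_⟩
  have hmeas := fun k => AEMeasurable.comp_quasiMeasurePreserving
    (CoCoA.aemeasurable_blockError (n := n) (K : ℝ)⁻¹ (CoCoA.vecBlock x k)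
      fun l : {j : CoCoA.Idx p // j.1 ≠ k} => x l)
    (CoCoA.measurePreserving_block_rest k).quasiMeasurePreserving
  rw [CoCoA.generalizationError, ← CoCoA.sum_error_eq x fun k => CoCoA.lintegral_pinv_sq hn (hp k)]
  congr 1
  simp_rw [CoCoA.ofReal_norm_sub_estimate_sq]
  rw [hlaw.lintegral_comp (f := fun X => ∑ k, CoCoA.blockError (K : ℝ)⁻¹ (CoCoA.vecBlock x k)
    (fun l : {j : CoCoA.Idx p // j.1 ≠ k} => x l) (CoCoA.blockRows k X) (CoCoA.restEntries k X))
    (Finset.aemeasurable_fun_sum _ fun k _ => hmeas k)]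
  refine (lintegral_finsetSum' _ fun k _ => hmeas k).trans ?_
  refine Finset.sum_congr rfl fun k _ => ?_
  rw [← CoCoA.lintegral_blockError]
  exact (CoCoA.measurePreserving_block_rest k).hasLaw.lintegral_comp
    (CoCoA.aemeasurable_blockError (K : ℝ)⁻¹ (CoCoA.vecBlock x k) _)
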